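/- Let $\mathbb{D}$ be a countably infinite data domain, encoded by natural numbers, with equality as its only predicate. Constraints are generated by $b ::= \mathsf{true} \mid e=f \mid \neg b \mid b\wedge b$, where $e,f$ range over data variables and the placeholder $\star$ for the current action. The fragment $\mathrm{disjHML}^d$ of Hennessy--Milner logic with recursion and data is generated by $$\varphi ::= \mathsf{tt} \mid \langle b\rangle\varphi \mid \exists x.\varphi \mid \varphi\vee\varphi \mid \min X.\varphi \mid X ,$$ and is interpreted over infinite traces $t\in\mathbb{D}^\omega$. Given a finite partial assignment $\delta$ of data values to data variables, $\langle b\rangle\varphi$ holds of $t=du$ ($d\in\mathbb{D}$) iff $b$ is true under $\delta[\star\mapsto d]$ and $\varphi$ holds of $u$ under $\delta$; $\exists x.\varphi$ holds iff $\varphi$ holds under $\delta[x\mapsto d]$ for some $d\in\mathbb{D}$; $\mathsf{tt}$ and $\vee$ are as usual; and $\min X.\varphi$ denotes the least fixed point of the induced operator on functions from such assignments to sets of traces. For a closed formula $\varphi$ (no free data or recursion variables), $[\![\varphi]\!]\subseteq\mathbb{D}^\omega$ denotes the set of traces that satisfy it. A monitor $m$ consists of predicates $\mathbf{acc}(m,\cdot)$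 and $\mathbf{rej}(m,\cdot)$ on finite traces that are never both true and that are each preserved when the trace is extended; $m$ accepts (rejects) an infinite trace if it accepts (rejects) some finite prefix of it. Theorem. There is an algorithm that, given any closed formula $\varphi$ of $\mathrm{disjHML}^d$, outputs a program which halts on every finite trace $w\in\mathbb{D}^*$ with a verdict (accept, reject or neither), and whose verdicts define a monitor $m$ such that: 1. (soundness) every infinite trace accepted by $m$ is in $[\![\varphi]\!]$, and no infinite trace rejected by $m$ is in $[\![\varphi]\!]$; 2. (satisfaction-completeness) every $t\in[\![\varphi]\!]$ is accepted by $m$; 3. (violation-optimality) every bad prefix for $[\![\varphi]\!]$, i.e. every $w\in\mathbb{D}^*$ with $w\,\mathbb{D}^\omega\cap[\![\varphi]\!]=\varnothing$, is rejected by $m$. -/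

import Mathlib

namespace RecHML

/-! ## Syntax

Data variables and formula variables are natural numbers. -/

/-- The expressions `e, f`: data variables, and the placeholder for the current action. -/
inductive DExp : Type
  | var (x : ℕ)
  | star

/-- The quantifier-free Boolean constraint expressions `b, c`. -/
inductive BExp : Type
  | tru
  | eq (e f : DExp)
  | not (b : BExp)
  | and (b c : BExp)

/-- The formulae of Hennessy-Milner logic with recursion and data. -/
inductive Formula : Type
  | tt
  | ff
  | dia (b : BExp) (φ : Formula)
  | box (b : BExp) (φ : Formula)
  | ex (x : ℕ) (φ : Formula)
  | all (x : ℕ) (φ : Formula)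
  | or (φ ψ : Formula)
  | and (φ ψ : Formula)
  | lfp (X : ℕ) (φ : Formula)
  | gfp (X : ℕ) (φ : Formula)
  | fvar (X : ℕ)

/-- The data variables of an expression. -/
def DExp.vars : DExp → Finset ℕ
  | .var x => {x}
  | .star => ∅

/-- The data variables of a constraint. -/
def BExp.vars : BExp → Finset ℕ
  | .tru => ∅
  | .eq e f => e.vars ∪ f.vars
  | .not b => b.vars
  | .and b c => b.vars ∪ c.vars

/-- The free data variables of a formula. -/
def Formula.freeData : Formula → Finset ℕ
  | .tt => ∅
  | .ff => ∅
  | .dia b φ => b.vars ∪ φ.freeData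
  | .box b φ => b.vars ∪ φ.freeData
  | .ex x φ => φ.freeData.erase x
  | .all x φ => φ.freeData.erase x
  | .or φ ψ => φ.freeData ∪ ψ.freeData
  | .and φ ψ => φ.freeData ∪ ψ.freeData
  | .lfp _ φ => φ.freeData
  | .gfp _ φ => φ.freeData
  | .fvar _ => ∅

/-- The free formula (recursion) variables of a formula. -/
def Formula.freeRec : Formula → Finset ℕ
  | .tt => ∅
  | .ff => ∅
  | .dia _ φ => φ.freeRec
  | .box _ φ => φ.freeRec
  | .ex _ φ => φ.freeRec
  | .all _ φ => φ.freeRec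
  | .or φ ψ => φ.freeRec ∪ ψ.freeRec
  | .and φ ψ => φ.freeRec ∪ ψ.freeRec
  | .lfp X φ => φ.freeRec.erase X
  | .gfp X φ => φ.freeRec.erase X
  | .fvar X => {X}

/-- A formula is closed if it has neither free data variables nor free recursion variables. -/
def Formula.IsClosed (φ : Formula) : Prop := φ.freeData = ∅ ∧ φ.freeRec = ∅

/-- The fragment `disjHMLd`, generated by `tt`, possibility, existential quantification,
disjunction, least fixed points and recursion variables. -/
def Formula.IsDisj : Formula → Prop
  | .tt => True
  | .ff => False
  | .dia _ φ => φ.IsDisj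
  | .box _ _ => False
  | .ex _ φ => φ.IsDisj
  | .all _ _ => False
  | .or φ ψ => φ.IsDisj ∧ ψ.IsDisj
  | .and _ _ => False
  | .lfp _ φ => φ.IsDisj
  | .gfp _ _ => False
  | .fvar _ => True

/-! ## Gödel numbers, the inputs of the synthesis algorithm -/

/-- Gödel number of an expression. -/
def DExp.code : DExp → ℕ
  | .var x => x + 1
  | .star => 0

/-- Gödel number of a constraint. -/
def BExp.code : BExp → ℕ
  | .tru => Nat.pair 1 0
  | .eq e f => Nat.pair 2 (Nat.pair e.code f.code)
  | .not b => Nat.pair 3 b.code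
  | .and b c => Nat.pair 4 (Nat.pair b.code c.code)

/-- Gödel number of a formula. -/
def Formula.code : Formula → ℕ
  | .tt => Nat.pair 1 0
  | .ff => Nat.pair 2 0
  | .dia b φ => Nat.pair 3 (Nat.pair b.code φ.code)
  | .box b φ => Nat.pair 4 (Nat.pair b.code φ.code)
  | .ex x φ => Nat.pair 5 (Nat.pair x φ.code)
  | .all x φ => Nat.pair 6 (Nat.pair x φ.code)
  | .or φ ψ => Nat.pair 7 (Nat.pair φ.code ψ.code)
  | .and φ ψ => Nat.pair 8 (Nat.pair φ.code ψ.code)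
  | .lfp X φ => Nat.pair 9 (Nat.pair X φ.code)
  | .gfp X φ => Nat.pair 10 (Nat.pair X φ.code)
  | .fvar X => Nat.pair 11 X

/-! ## Linear-time semantics over a data domain `D`

Infinite traces are elements of `Stream' D`, finite traces elements of `List D`. -/

/-- Data environments: partial functions with finite domain from data variables to `D`. -/
abbrev DEnv (D : Type*) := Finmap (fun _ : ℕ => D)

/-- Data interpretations, ordered pointwise by inclusion. -/
abbrev DInt (D : Type*) := DEnv D → Set (Stream' D)

/-- Trace environments. They are total here; closed formulae do not depend on them. -/
abbrev TEnv (D : Type*) := ℕ → DInt D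

/-- Value of an expression when the current action is `d`; `none` if it is an unassigned
variable, which does not happen in the evaluation of a closed formula. -/
def DExp.eval {D : Type*} (δ : DEnv D) (d : D) : DExp → Option D
  | .var x => δ.lookup x
  | .star => some d

/-- Truth of a constraint when the current action is `d`. -/
def BExp.Holds {D : Type*} (δ : DEnv D) (d : D) : BExp → Prop
  | .tru => True
  | .eq e f => e.eval δ d = f.eval δ d
  | .not b => ¬ b.Holds δ d
  | .and b c => b.Holds δ d ∧ c.Holds δ d

/-- The linear-time semantics. The infimum and supremum are those of the complete lattice
`DInt D`. -/
def Formula.sem {D : Type*} : Formula → TEnv D → DInt D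
  | .tt, _, _ => Set.univ
  | .ff, _, _ => ∅
  | .dia b φ, ρ, δ =>
      {t | ∃ (u : Stream' D) (d : D), t = Stream'.cons d u ∧ b.Holds δ d ∧ u ∈ φ.sem ρ δ}
  | .box b φ, ρ, δ =>
      {t | ∀ (u : Stream' D) (d : D), t = Stream'.cons d u ∧ b.Holds δ d → u ∈ φ.sem ρ δ}
  | .ex x φ, ρ, δ => ⋃ d : D, φ.sem ρ (δ.insert x d)
  | .all x φ, ρ, δ => ⋂ d : D, φ.sem ρ (δ.insert x d)
  | .or φ ψ, ρ, δ => φ.sem ρ δ ∪ ψ.sem ρ δ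
  | .and φ ψ, ρ, δ => φ.sem ρ δ ∩ ψ.sem ρ δ
  | .lfp X φ, ρ, δ =>
      sInf {F : DInt D | (fun δ' => φ.sem (Function.update ρ X F) δ') ≤ F} δ
  | .gfp X φ, ρ, δ =>
      sSup {F : DInt D | F ≤ (fun δ' => φ.sem (Function.update ρ X F) δ')} δ
  | .fvar X, ρ, δ => ρ X δ

/-- The set of infinite traces that satisfy a closed formula. -/
def Formula.traces (D : Type*) (φ : Formula) : Set (Stream' D) :=
  φ.sem (fun _ _ => ∅) ∅

/-! ## Monitors -/

/-- A monitor, given by its acceptance and rejection predicates on finite traces, which are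
consistent and irrevocable. -/
structure Monitor (D : Type*) where
  acc : List D → Prop
  rej : List D → Prop
  consistent : ∀ w, ¬ (acc w ∧ rej w)
  acc_irrevocable : ∀ w y, w <+: y → acc w → acc y
  rej_irrevocable : ∀ w y, w <+: y → rej w → rej y

namespace Monitor

variable {D : Type*}

/-- The infinite trace `t` is accepted: some finite prefix of `t` is. -/
def AccTrace (m : Monitor D) (t : Stream' D) : Prop :=
  ∃ (w : List D) (u : Stream' D), t = w ++ₛ u ∧ m.acc w

/-- The infinite trace `t` is rejected: some finite prefix of `t` is. -/
def RejTrace (m : Monitor D) (t : Stream' D) : Prop :=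
  ∃ (w : List D) (u : Stream' D), t = w ++ₛ u ∧ m.rej w

/-- Soundness, for satisfactions and for violations. -/
def Sound (m : Monitor D) (T : Set (Stream' D)) : Prop :=
  (∀ t, m.AccTrace t → t ∈ T) ∧ (∀ t, m.RejTrace t → t ∉ T)

/-- Completeness for satisfactions. -/
def SatisfactionComplete (m : Monitor D) (T : Set (Stream' D)) : Prop :=
  ∀ t, t ∈ T → m.AccTrace t

end Monitor

/-- `w` is a bad prefix for `T`: no infinite continuation of `w` is in `T`. -/
def IsBadPrefix {D : Type*} (T : Set (Stream' D)) (w : List D) : Prop :=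
  ∀ u : Stream' D, w ++ₛ u ∉ T

/-- Violation-optimality: every bad prefix is rejected. -/
def Monitor.ViolationOptimal {D : Type*} (m : Monitor D) (T : Set (Stream' D)) : Prop :=
  ∀ w : List D, IsBadPrefix T w → m.rej w

/-- The program `c` computes the monitor `m`: on (the code of) every finite trace `w` it halts,
with output `1` exactly if `m` accepts `w` and output `2` exactly if `m` rejects `w`. -/
def Monitor.ComputedBy {D : Type*} [Encodable D] (m : Monitor D) (c : Nat.Partrec.Code) : Prop :=
  ∀ w : List D, ∃ v : ℕ, v ∈ c.eval (Encodable.encode w) ∧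
    (v = 1 ↔ m.acc w) ∧ (v = 2 ↔ m.rej w)

end RecHML

namespace RecHML

/-! The fragment has no conjunction, box, universal quantifier or greatest fixed point, so
satisfaction is witnessed by a single finite path of choices, a derivation of `Run`. That the
semantics amounts to existence of runs is `Formula.mem_traces_iff`: least fixed points are closed
under unfolding, which interprets every run, and the traces with a run form a prefixed point, which
therefore contains the least one. A run reads finitely many letters, so it already succeeds on a
prefix of its trace. A run never branches, so letters guessed past the end of a word assemble into
one continuation. Hence `w` may be accepted iff it has a run confined to its own letters, and it is
a bad prefix iff it has no run that may guess letters after its end.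

Both conditions are decidable. Equality being the only predicate, runs are preserved by injective
renaming of values. At any moment only the values of at most `N` variables and the remaining letters
matter, so in a pool of more than `N + |w|` values there is always room for the next value chosen
(`Run.map_into_finset`). Over a finite pool only finitely many configurations are reachable
(`finite_setOf_reaches`), and a search continued until nothing new appears finds all of them. The
search works on Gödel numbers and is partial recursive uniformly in the formula; currying that one
program gives the synthesis. -/

/-- A stack of least fixed points, innermost first, binding formula variables to their bodies. -/
abbrev RecStack := List (ℕ × Formula)

/-- Value of an expression under a functional data environment. -/
def DExp.value {D : Type*} (η : ℕ → Option D) (d : D) : DExp → Option D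
  | .var x => η x
  | .star => some d

/-- Truth of a constraint under a functional data environment. -/
def BExp.Sat {D : Type*} (η : ℕ → Option D) (d : D) : BExp → Prop
  | .tru => True
  | .eq e f => e.value η d = f.value η d
  | .not b => ¬ b.Sat η d
  | .and b c => b.Sat η d ∧ c.Sat η d

/-- Successful finite evaluations of a formula on an input `s`, from which letters are taken by
the relation `read`. Quantified values are taken from `V`. -/
inductive Run {D S : Type*} (V : Set D) (read : S → D → S → Prop) :
    Formula → RecStack → (ℕ → Option D) → S → Prop
  | tt {σ η s} : Run V read .tt σ η s
  | dia {b ψ σ η s} (d : D) (s' : S) (hr : read s d s') (hb : b.Sat η d)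
      (h : Run V read ψ σ η s') : Run V read (.dia b ψ) σ η s
  | ex {x ψ σ η s} (d : D) (hd : d ∈ V)
      (h : Run V read ψ σ (Function.update η x (some d)) s) : Run V read (.ex x ψ) σ η s
  | orl {ψ χ σ η s} (h : Run V read ψ σ η s) : Run V read (.or ψ χ) σ η s
  | orr {ψ χ σ η s} (h : Run V read χ σ η s) : Run V read (.or ψ χ) σ η s
  | lfp {X ψ σ η s} (h : Run V read ψ ((X, ψ) :: σ) η s) : Run V read (.lfp X ψ) σ η s
  | hit {X β σ η s} (h : Run V read β ((X, β) :: σ) η s) :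
      Run V read (.fvar X) ((X, β) :: σ) η s
  | miss {X Y β σ η s} (hXY : X ≠ Y) (h : Run V read (.fvar X) σ η s) :
      Run V read (.fvar X) ((Y, β) :: σ) η s

/-- Reading the first letter of an infinite trace. -/
def streamRead {D : Type*} (t : Stream' D) (d : D) (u : Stream' D) : Prop :=
  t = Stream'.cons d u

/-- Reading the first letter of a finite trace; past its end, any letter in `L` may be read. -/
def listRead {D : Type*} (L : Set D) : List D → D → List D → Prop
  | [], d, w => d ∈ L ∧ w = []
  | a :: l, d, w => d = a ∧ w = l

/-! ## Adequacy of runs for the semantics -/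

section Adequacy

variable {D : Type*}

theorem DExp.eval_eq_value (δ : DEnv D) (d : D) (e : DExp) :
    e.eval δ d = e.value (fun x => δ.lookup x) d := by
  cases e <;> rfl

theorem BExp.holds_iff_sat (δ : DEnv D) (d : D) (b : BExp) :
    b.Holds δ d ↔ b.Sat (fun x => δ.lookup x) d := by
  induction b with
  | tru => exact Iff.rfl
  | eq e f => simp only [BExp.Holds, BExp.Sat, DExp.eval_eq_value]
  | not b ih => simp only [BExp.Holds, BExp.Sat, ih]
  | and b c ihb ihc => simp only [BExp.Holds, BExp.Sat, ihb, ihc]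

theorem lookup_insert_eq_update (δ : DEnv D) (x : ℕ) (d : D) :
    (fun y => (δ.insert x d).lookup y) = Function.update (fun y => δ.lookup y) x (some d) := by
  funext y
  by_cases h : y = x
  · subst h; simp
  · rw [Finmap.lookup_insert_of_ne _ h, Function.update_of_ne h]

/-- Monotonicity makes the infimum of the prefixed points itself a prefixed point. This half of
Knaster–Tarski, `Formula.sem_unfold_le`, is the only half needed to interpret runs. -/
theorem Formula.sem_mono {φ : Formula} (hφ : φ.IsDisj) {ρ ρ' : TEnv D} (h : ρ ≤ ρ') :
    φ.sem ρ ≤ φ.sem ρ' := by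
  induction φ generalizing ρ ρ' with
  | tt => exact le_rfl
  | ff => exact le_rfl
  | dia b φ ih =>
    rintro δ t ⟨u, d, rfl, hb, hu⟩
    exact ⟨u, d, rfl, hb, ih hφ h δ hu⟩
  | box => exact hφ.elim
  | ex x φ ih =>
    intro δ t ht
    simp only [Formula.sem, Set.mem_iUnion] at ht ⊢
    exact ht.imp fun d hd => ih hφ h _ hd
  | all => exact hφ.elim
  | or φ ψ ih₁ ih₂ =>
    rintro δ t (ht | ht)
    · exact Or.inl (ih₁ hφ.1 h δ ht)
    · exact Or.inr (ih₂ hφ.2 h δ ht)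
  | and => exact hφ.elim
  | lfp X φ ih =>
    have key : {F : DInt D | φ.sem (Function.update ρ' X F) ≤ F} ⊆
        {F : DInt D | φ.sem (Function.update ρ X F) ≤ F} := fun F hF =>
      (ih hφ (update_le_update_iff.2 ⟨le_rfl, fun Y _ => h Y⟩)).trans hF
    exact sInf_le_sInf key
  | gfp => exact hφ.elim
  | fvar X => exact h X

theorem Formula.sem_unfold_le {X : ℕ} {φ : Formula} (hφ : φ.IsDisj) (ρ : TEnv D) :
    φ.sem (Function.update ρ X ((Formula.lfp X φ).sem ρ)) ≤ (Formula.lfp X φ).sem ρ := by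
  refine le_sInf (a := φ.sem (Function.update ρ X ((Formula.lfp X φ).sem ρ))) ?_
  intro F hF
  refine le_trans (Formula.sem_mono hφ ?_) hF
  exact update_le_update_iff.2 ⟨sInf_le hF, fun _ _ => le_rfl⟩

theorem Formula.mem_sem_lfp {X : ℕ} {φ : Formula} (hφ : φ.IsDisj) {ρ : TEnv D} {δ : DEnv D}
    {t : Stream' D} (h : t ∈ φ.sem (Function.update ρ X ((Formula.lfp X φ).sem ρ)) δ) :
    t ∈ (Formula.lfp X φ).sem ρ δ := by
  have key : φ.sem (Function.update ρ X ((Formula.lfp X φ).sem ρ)) δ ⊆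
      (Formula.lfp X φ).sem ρ δ := Pi.le_def.1 (Formula.sem_unfold_le hφ ρ) δ
  exact key h

/-- The trace environment `ρ` interprets the variables bound by the stack by their fixed points. -/
def RecStack.Interpreted : RecStack → TEnv D → Prop
  | [], _ => True
  | (X, β) :: σ, ρ => β.IsDisj ∧ ∃ ρ', RecStack.Interpreted σ ρ' ∧
      ρ = Function.update ρ' X ((Formula.lfp X β).sem ρ')

/-- Induction on the run. A visit to a recursion variable (`hit`) is one unfolding of its fixed
point. The data environment at that moment is kept, since fixed points are functions of the
environment. -/
theorem Run.mem_sem {φ : Formula} {σ : RecStack} {η : ℕ → Option D} {t : Stream' D}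
    (h : Run Set.univ streamRead φ σ η t) (hφ : φ.IsDisj) {ρ : TEnv D}
    (hρ : σ.Interpreted ρ) {δ : DEnv D} (hδ : η = fun x => δ.lookup x) : t ∈ φ.sem ρ δ := by
  induction h generalizing ρ δ with
  | tt => trivial
  | dia d s' hr hb h ih =>
    subst hδ
    exact ⟨s', d, hr, (BExp.holds_iff_sat _ _ _).2 hb, ih hφ hρ rfl⟩
  | ex d hd h ih =>
    subst hδ
    exact Set.mem_iUnion.2 ⟨d, ih hφ hρ (lookup_insert_eq_update _ _ _).symm⟩
  | orl h ih => exact Or.inl (ih hφ.1 hρ hδ)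
  | orr h ih => exact Or.inr (ih hφ.2 hρ hδ)
  | @lfp X ψ σ η s h ih =>
    have : s ∈ ψ.sem (Function.update ρ X ((Formula.lfp X ψ).sem ρ)) δ :=
      ih hφ ⟨hφ, ρ, hρ, rfl⟩ hδ
    exact Formula.mem_sem_lfp (φ := ψ) hφ this
  | @hit X β σ η s h ih =>
    obtain ⟨hβ, ρ', hρ', rfl⟩ := hρ
    have := Formula.mem_sem_lfp hβ (ih hβ ⟨hβ, ρ', hρ', rfl⟩ hδ)
    rw [Formula.sem, Function.update_self]
    exact this
  | miss hXY h ih =>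
    obtain ⟨hβ, ρ', hρ', rfl⟩ := hρ
    rw [Formula.sem, Function.update_of_ne hXY]
    exact ih trivial hρ' hδ

/-- The interpretation of recursion variables by runs. -/
def RecStack.runEnv (σ : RecStack) : TEnv D := fun X δ =>
  {t | Run Set.univ streamRead (.fvar X) σ (fun x => δ.lookup x) t}

/-- The rules `hit` and `miss` are exactly the two cases of `Function.update`. -/
theorem RecStack.runEnv_cons (X : ℕ) (β : Formula) (σ : RecStack) :
    (RecStack.runEnv ((X, β) :: σ) : TEnv D) = Function.update σ.runEnv X
      fun δ => {t | Run Set.univ streamRead β ((X, β) :: σ) (fun x => δ.lookup x) t} := by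
  funext Y δ
  ext t
  by_cases hY : Y = X
  · subst hY
    rw [Function.update_self]
    constructor
    · intro h
      cases h with
      | hit h => exact h
      | miss hne => exact (hne rfl).elim
    · exact Run.hit
  · rw [Function.update_of_ne hY]
    constructor
    · intro h
      cases h with
      | hit h => exact (hY rfl).elim
      | miss _ h => exact h
    · exact Run.miss hY

theorem Run.of_mem_sem {φ : Formula} (hφ : φ.IsDisj) {σ : RecStack} {δ : DEnv D} {t : Stream' D}
    (h : t ∈ φ.sem σ.runEnv δ) : Run Set.univ streamRead φ σ (fun x => δ.lookup x) t := by
  induction φ generalizing σ δ t with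
  | tt => exact .tt
  | ff => exact hφ.elim
  | dia b φ ih =>
    obtain ⟨u, d, ht, hb, hu⟩ := h
    exact .dia d u ht ((BExp.holds_iff_sat _ _ _).1 hb) (ih hφ hu)
  | box => exact hφ.elim
  | ex x φ ih =>
    obtain ⟨d, hd⟩ := Set.mem_iUnion.1 h
    have := ih hφ hd
    rw [lookup_insert_eq_update] at this
    exact .ex d trivial this
  | all => exact hφ.elim
  | or φ ψ ih₁ ih₂ =>
    rcases h with h | h
    · exact .orl (ih₁ hφ.1 h)
    · exact .orr (ih₂ hφ.2 h)
  | and => exact hφ.elim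
  | lfp X φ ih =>
    refine .lfp ?_
    -- The runs of the body, with the binder pushed, form a prefixed point.
    have key : (Formula.lfp X φ).sem σ.runEnv ≤ fun δ : DEnv D =>
        {t | Run Set.univ streamRead φ ((X, φ) :: σ) (fun x => δ.lookup x) t} := by
      refine sInf_le ?_
      intro δ' t' ht'
      rw [← RecStack.runEnv_cons] at ht'
      exact ih hφ ht'
    exact key δ h
  | gfp => exact hφ.elim
  | fvar X => exact h

theorem Formula.mem_traces_iff {φ : Formula} (hφ : φ.IsDisj) {t : Stream' D} :
    t ∈ φ.traces D ↔ Run Set.univ streamRead φ [] (fun _ => none) t := by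
  have e : (fun _ : ℕ => (none : Option D)) = fun x => (∅ : DEnv D).lookup x := by
    funext x; simp
  rw [e]
  -- No rule applies to a variable with an empty stack, so it denotes the empty set, as in
  -- `Formula.traces`.
  have hρ : (RecStack.runEnv [] : TEnv D) = fun _ _ => ∅ := by
    funext X δ
    refine Set.eq_empty_of_forall_notMem fun t h => ?_
    cases h
  refine ⟨fun h => Run.of_mem_sem hφ ?_, fun h => h.mem_sem hφ trivial rfl⟩
  rw [hρ]
  exact h

end Adequacy

/-! ## Finite traces -/

section FiniteTraces

variable {D : Type*} {V : Set D} {φ : Formula} {σ : RecStack} {η : ℕ → Option D}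

/-- A run touches its input only through `read`, so a simulation between inputs transports it. This
gives the passages between finite and infinite traces. -/
theorem Run.simulate {S S' : Type*} {read : S → D → S → Prop} {read' : S' → D → S' → Prop}
    (R : S → S' → Prop)
    (hR : ∀ s s' d s₁, R s s' → read s d s₁ → ∃ s₁', read' s' d s₁' ∧ R s₁ s₁') {s : S}
    (h : Run V read φ σ η s) {s' : S'} (hs : R s s') : Run V read' φ σ η s' := by
  induction h generalizing s' with
  | tt => exact .tt
  | dia d s₁ hr hb h ih =>
    obtain ⟨s₁', hr', h₁⟩ := hR _ _ _ _ hs hr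
    exact .dia d s₁' hr' hb (ih h₁)
  | ex d hd h ih => exact .ex d hd (ih hs)
  | orl h ih => exact .orl (ih hs)
  | orr h ih => exact .orr (ih hs)
  | lfp h ih => exact .lfp (ih hs)
  | hit h ih => exact .hit (ih hs)
  | miss hXY h ih => exact .miss hXY (ih hs)

theorem Run.append_stream {w : List D} (h : Run V (listRead ∅) φ σ η w) (u : Stream' D) :
    Run V streamRead φ σ η (w ++ₛ u) := by
  refine h.simulate (fun w t => t = w ++ₛ u) ?_ rfl
  rintro (_ | ⟨a, w⟩) _ d w₁ rfl hr
  · exact hr.1.elim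
  · obtain ⟨rfl, rfl⟩ := hr
    exact ⟨_, Stream'.cons_append_stream _ _ _, rfl⟩

theorem Run.mono_prefix {w y : List D} (h : Run V (listRead ∅) φ σ η w) (hwy : w <+: y) :
    Run V (listRead ∅) φ σ η y := by
  refine h.simulate (fun w y => w <+: y) ?_ hwy
  rintro (_ | ⟨a, w⟩) y d w₁ hy hr
  · exact hr.1.elim
  · obtain ⟨rfl, rfl⟩ := hr
    obtain ⟨z, rfl⟩ := hy
    exact ⟨w₁ ++ z, ⟨rfl, rfl⟩, z, rfl⟩

theorem Run.prefix_of_stream {w : List D} {u : Stream' D}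
    (h : Run V streamRead φ σ η (w ++ₛ u)) : Run V (listRead Set.univ) φ σ η w := by
  refine h.simulate (fun t w => ∃ u, t = w ++ₛ u) ?_ ⟨u, rfl⟩
  rintro _ (_ | ⟨a, w⟩) d t₁ ⟨u, rfl⟩ hr
  · exact ⟨[], ⟨trivial, rfl⟩, t₁, rfl⟩
  · rw [streamRead, Stream'.cons_append_stream] at hr
    obtain ⟨rfl, rfl⟩ := Stream'.cons_injective2 hr
    exact ⟨w, ⟨rfl, rfl⟩, u, rfl⟩

theorem Run.exists_prefix {t : Stream' D} (h : Run V streamRead φ σ η t) :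
    ∃ (w : List D) (u : Stream' D), t = w ++ₛ u ∧ Run V (listRead ∅) φ σ η w := by
  induction h with
  | @tt σ η s => exact ⟨[], s, rfl, .tt⟩
  | dia d s' hr hb h ih =>
    obtain ⟨w, u, rfl, hw⟩ := ih
    exact ⟨d :: w, u, hr, .dia d w ⟨rfl, rfl⟩ hb hw⟩
  | ex d hd h ih => exact ih.imp fun w => Exists.imp fun u => And.imp_right (.ex d hd)
  | orl h ih => exact ih.imp fun w => Exists.imp fun u => And.imp_right .orl
  | orr h ih => exact ih.imp fun w => Exists.imp fun u => And.imp_right .orr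
  | lfp h ih => exact ih.imp fun w => Exists.imp fun u => And.imp_right .lfp
  | hit h ih => exact ih.imp fun w => Exists.imp fun u => And.imp_right .hit
  | miss hXY h ih => exact ih.imp fun w => Exists.imp fun u => And.imp_right (.miss hXY)

/-- The continuation is built backwards along the run: each letter guessed past the end is put in
front of what follows, and after `tt` the rest is arbitrary. A conjunction would break this, since
two branches could guess differently. -/
theorem Run.exists_append_stream [Nonempty D] {w : List D}
    (h : Run V (listRead Set.univ) φ σ η w) :
    ∃ u : Stream' D, Run V streamRead φ σ η (w ++ₛ u) := by
  induction h with
  | tt => exact ⟨Stream'.const (Classical.arbitrary D), .tt⟩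
  | @dia b ψ σ η s d s' hr hb h ih =>
    obtain ⟨u, hu⟩ := ih
    cases s with
    | nil =>
      obtain ⟨-, rfl⟩ := hr
      exact ⟨Stream'.cons d u, .dia d u rfl hb hu⟩
    | cons a w =>
      obtain ⟨rfl, rfl⟩ := hr
      exact ⟨u, .dia d _ (Stream'.cons_append_stream _ _ _) hb hu⟩
  | ex d hd h ih => exact ih.imp fun u => .ex d hd
  | orl h ih => exact ih.imp fun u => .orl
  | orr h ih => exact ih.imp fun u => .orr
  | lfp h ih => exact ih.imp fun u => .lfp
  | hit h ih => exact ih.imp fun u => .hit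
  | miss hXY h ih => exact ih.imp fun u => .miss hXY

end FiniteTraces

/-! ## Renaming of data values -/

section Renaming

variable {D E : Type*}

/-- Constraints may negate equalities, so equality must be reflected as well as preserved; hence
injectivity. -/
theorem BExp.sat_map_iff {f : D → E} (hf : f.Injective) (η : ℕ → Option D) (d : D) (b : BExp) :
    b.Sat (fun x => (η x).map f) (f d) ↔ b.Sat η d := by
  have he (e : DExp) : e.value (fun x => (η x).map f) (f d) = (e.value η d).map f := by
    cases e <;> rfl
  induction b with
  | tru => exact Iff.rfl
  | eq e e' => simp only [BExp.Sat, he, (Option.map_injective hf).eq_iff]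
  | not b ih => simp only [BExp.Sat, ih]
  | and b c ihb ihc => simp only [BExp.Sat, ihb, ihc]

theorem map_update (f : D → E) (η : ℕ → Option D) (x : ℕ) (d : D) :
    (fun y => (Function.update η x (some d) y).map f) =
      Function.update (fun y => (η y).map f) x (some (f d)) := by
  funext y
  by_cases h : y = x
  · subst h; simp
  · simp [Function.update_of_ne h]

theorem Run.map {V L : Set D} {V' L' : Set E} {f : D → E} (hf : f.Injective)
    (hV : Set.MapsTo f V V') (hL : Set.MapsTo f L L') {φ : Formula} {σ : RecStack}
    {η : ℕ → Option D} {w : List D} (h : Run V (listRead L) φ σ η w) :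
    Run V' (listRead L') φ σ (fun x => (η x).map f) (w.map f) := by
  induction h with
  | tt => exact .tt
  | @dia b ψ σ η s d s' hr hb h ih =>
    refine .dia (f d) _ ?_ ((BExp.sat_map_iff hf η d b).2 hb) ih
    cases s with
    | nil => exact ⟨hL hr.1, by rw [hr.2]; rfl⟩
    | cons a w => exact ⟨by rw [hr.1], by rw [hr.2]⟩
  | ex d hd h ih =>
    rw [map_update] at ih
    exact .ex (f d) (hV hd) ih
  | orl h ih => exact .orl ih
  | orr h ih => exact .orr ih
  | lfp h ih => exact .lfp ih
  | hit h ih => exact .hit ih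
  | miss hXY h ih => exact .miss hXY ih

/-- An injection can be modified so as to send `d` into `A`, without changing its values in the
rather small subset `B` of `A`. -/
theorem exists_injective_eqOn_mem [DecidableEq E] {f : D → E} (hf : f.Injective) {A B : Finset E}
    (hBA : B ⊆ A) (hcard : B.card < A.card) (d : D) :
    ∃ g : D → E, g.Injective ∧ (∀ e, f e ∈ B → g e = f e) ∧ g d ∈ A := by
  by_cases hd : f d ∈ A
  · exact ⟨f, hf, fun _ _ => rfl, hd⟩
  obtain ⟨a, haA, haB⟩ := Finset.exists_mem_notMem_of_card_lt_card hcard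
  refine ⟨Equiv.swap (f d) a ∘ f, (Equiv.swap (f d) a).injective.comp hf, fun e he => ?_, ?_⟩
  · refine Equiv.swap_apply_of_ne_of_ne ?_ ?_
    · exact fun h => hd (h ▸ hBA he)
    · exact fun h => haB (h ▸ he)
  · simpa using haA

/-! ### Control points and runs over a small pool of values -/

/-- The control successors of a formula with its stack. -/
def control : Formula × RecStack → List (Formula × RecStack)
  | (.dia _ ψ, σ) => [(ψ, σ)]
  | (.ex _ ψ, σ) => [(ψ, σ)]
  | (.or ψ χ, σ) => [(ψ, σ), (χ, σ)]
  | (.lfp X ψ, σ) => [(ψ, (X, ψ) :: σ)]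
  | (.fvar X, (Y, β) :: σ) => if Y = X then [(β, (Y, β) :: σ)] else [(.fvar X, σ)]
  | _ => []

/-- `U` is closed under control successors and quantifies only variables below `N`. -/
structure ControlClosed (U : Set (Formula × RecStack)) (N : ℕ) : Prop where
  mem_of_control : ∀ c ∈ U, ∀ c' ∈ control c, c' ∈ U
  lt_of_ex : ∀ x ψ σ, (Formula.ex x ψ, σ) ∈ U → x < N

/-- The renaming `f` is not fixed along the run. At each choice of a value it is replaced by an
injection that agrees with it on the live values only, so the pool places of forgotten values are
reused. The hypothesis on `L` covers both modes: no letters past the end, or all of them. -/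
theorem Run.map_into_finset [DecidableEq E] {U : Set (Formula × RecStack)} {N : ℕ}
    (hU : ControlClosed U N) {L : Set D} {L' : Set E} {A : Finset E} {k : ℕ}
    (hA : N + k < A.card) (hL : L.Nonempty → ↑A ⊆ L') {φ : Formula} {σ : RecStack}
    {η : ℕ → Option D} {w : List D} (h : Run Set.univ (listRead L) φ σ η w) {f : D → E}
    (hf : f.Injective) (hη : ∀ x d, η x = some d → x < N ∧ f d ∈ A) (hw : ∀ d ∈ w, f d ∈ A)
    (hk : w.length ≤ k) (hφ : (φ, σ) ∈ U) :
    Run A (listRead L') φ σ (fun x => (η x).map f) (w.map f) := by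
  have fresh (η : ℕ → Option D) (w : List D) (f : D → E) (hf : f.Injective)
      (hη : ∀ x d, η x = some d → x < N ∧ f d ∈ A) (hw : ∀ d ∈ w, f d ∈ A)
      (hk : w.length ≤ k) (d : D) : ∃ g : D → E, g.Injective ∧ g d ∈ A ∧
        (∀ x e, η x = some e → g e = f e) ∧ ∀ e ∈ w, g e = f e := by
    -- The live values: those of the variables below `N` and those in the remaining word, at most `N
    -- + k` in number.
    let B : Finset E := ((Finset.range N).biUnion fun x => ((η x).map f).toFinset) ∪
      (w.map f).toFinset
    have hBA : B ⊆ A := by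
      intro b hb
      rcases Finset.mem_union.1 hb with hb | hb
      · simp only [Finset.mem_biUnion, Option.mem_toFinset, Option.mem_def,
          Option.map_eq_some_iff] at hb
        obtain ⟨x, -, e, he, rfl⟩ := hb
        exact (hη x e he).2
      · simp only [List.mem_toFinset, List.mem_map] at hb
        obtain ⟨e, he, rfl⟩ := hb
        exact hw e he
    have hBc : B.card < A.card := by
      refine lt_of_le_of_lt (Finset.card_union_le _ _) (lt_of_le_of_lt (Nat.add_le_add ?_ ?_) hA)
      · refine Finset.card_biUnion_le.trans ?_
        refine (Finset.sum_le_card_nsmul _ _ 1 fun x _ => ?_).trans (by simp)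
        cases η x <;> simp
      · exact (List.toFinset_card_le _).trans (by simpa using hk)
    obtain ⟨g, hg, hgB, hgd⟩ := exists_injective_eqOn_mem hf hBA hBc d
    refine ⟨g, hg, hgd, fun x e he => hgB e ?_, fun e he => hgB e ?_⟩
    · refine Finset.mem_union_left _ (Finset.mem_biUnion.2
        ⟨x, Finset.mem_range.2 (hη x e he).1, ?_⟩)
      simp [he]
    · exact Finset.mem_union_right _ (by simpa using ⟨e, he, rfl⟩)
  have map_congr (η : ℕ → Option D) (f g : D → E) (h : ∀ x e, η x = some e → g e = f e) :
      (fun x => (η x).map f) = fun x => (η x).map g := by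
    funext x
    cases hx : η x with
    | none => rfl
    | some e => simp [h x e hx]
  induction h generalizing f with
  | tt => exact .tt
  | @dia b ψ σ η s d s' hr hb h ih =>
    have hψ : (ψ, σ) ∈ U := hU.mem_of_control _ hφ _ (by simp [control])
    cases s with
    | nil =>
      obtain ⟨hd, rfl⟩ := hr
      -- A letter guessed past the end need not be sent into the pool by `f`; a letter of the word
      -- is, by `hw`.
      obtain ⟨g, hg, hgd, hgη, -⟩ := fresh η [] f hf hη hw hk d
      rw [map_congr η f g hgη]
      refine .dia (g d) [] ⟨hL ⟨d, hd⟩ hgd, rfl⟩ ((BExp.sat_map_iff hg η d b).2 hb)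
        (ih hg (fun x e he => ⟨(hη x e he).1, ?_⟩) (by simp) hk hψ)
      rw [hgη x e he]
      exact (hη x e he).2
    | cons a w =>
      obtain ⟨rfl, rfl⟩ := hr
      exact .dia (f d) _ ⟨rfl, rfl⟩ ((BExp.sat_map_iff hf η d b).2 hb)
        (ih hf hη (fun e he => hw e (List.mem_cons_of_mem _ he))
          (le_trans (by simp) hk) hψ)
  | @ex x ψ σ η s d hd h ih =>
    have hψ : (ψ, σ) ∈ U := hU.mem_of_control _ hφ _ (by simp [control])
    obtain ⟨g, hg, hgd, hgη, hgw⟩ := fresh η s f hf hη hw hk d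
    rw [map_congr η f g hgη, List.map_congr_left fun e he => (hgw e he).symm]
    refine .ex (g d) hgd ?_
    rw [← map_update]
    refine ih hg (fun y e he => ?_) (fun e he => by rw [hgw e he]; exact hw e he) hk hψ
    by_cases hy : y = x
    · subst hy
      rw [Function.update_self, Option.some_inj] at he
      subst he
      exact ⟨hU.lt_of_ex _ _ _ hφ, hgd⟩
    · rw [Function.update_of_ne hy] at he
      rw [hgη y e he]
      exact hη y e he
  | orl h ih => exact .orl (ih hf hη hw hk (hU.mem_of_control _ hφ _ (by simp [control])))
  | orr h ih => exact .orr (ih hf hη hw hk (hU.mem_of_control _ hφ _ (by simp [control])))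
  | lfp h ih => exact .lfp (ih hf hη hw hk (hU.mem_of_control _ hφ _ (by simp [control])))
  | hit h ih => exact .hit (ih hf hη hw hk (hU.mem_of_control _ hφ _ (by simp [control])))
  | miss hXY h ih =>
    exact .miss hXY (ih hf hη hw hk
      (hU.mem_of_control _ hφ _ (by simp [control, hXY.symm])))

/-- A bijection between two countably infinite types can be made to agree with an injection on
finitely many arguments. -/
theorem exists_equiv_eq_on_list [DecidableEq E] (e₀ : D ≃ E) {f : D → E} (hf : f.Injective)
    (l : List D) : ∃ e : D ≃ E, ∀ d ∈ l, e d = f d := by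
  induction l with
  | nil => exact ⟨e₀, by simp⟩
  | cons a l ih =>
    obtain ⟨e, he⟩ := ih
    refine ⟨e.trans (Equiv.swap (e a) (f a)), fun d hd => ?_⟩
    by_cases hda : d = a
    · subst hda; simp
    · have hdl := he d (List.mem_of_ne_of_mem hda hd)
      rw [Equiv.trans_apply, Equiv.swap_apply_of_ne_of_ne (e.injective.ne hda), hdl]
      rw [hdl]
      exact hf.ne hda

end Renaming

/-! ## Configurations and their successors -/

/-- The value of the variable `x` in the list `l`; the entry `d + 1` stands for the value `d`. -/
def envVal (l : List ℕ) (x : ℕ) : Option ℕ :=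
  Nat.casesOn (l.getD x 0) none some

/-- Assigning the value `d` to the variable `x`. -/
def envSet (l : List ℕ) (x d : ℕ) : List ℕ :=
  (List.range (max l.length (x + 1))).map fun y => if y = x then d + 1 else l.getD y 0

theorem envSet_getD (l : List ℕ) (x d y : ℕ) :
    (envSet l x d).getD y 0 = if y = x then d + 1 else l.getD y 0 := by
  by_cases hy : y < max l.length (x + 1)
  · simp [envSet, List.getD_eq_getElem?_getD, hy]
  · have h1 : ¬ y = x := by omega
    have h2 : l.length ≤ y := by omega
    rw [List.getD_eq_default _ _ (by simpa [envSet] using hy), if_neg h1,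
      List.getD_eq_default _ _ h2]

theorem envVal_envSet (l : List ℕ) (x d : ℕ) :
    envVal (envSet l x d) = Function.update (envVal l) x (some d) := by
  funext y
  by_cases h : y = x
  · subst h
    rw [Function.update_self, envVal, envSet_getD, if_pos rfl]
  · rw [Function.update_of_ne h, envVal, envSet_getD, if_neg h]
    rfl

/-- The letters that can be read, each with the remaining word. -/
def wordReads (L : List ℕ) (w : List ℕ) : List (ℕ × List ℕ) :=
  List.casesOn w (L.map fun d => (d, [])) fun a w => [(a, w)]

theorem mem_wordReads {L w : List ℕ} {p : ℕ × List ℕ} :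
    p ∈ wordReads L w ↔ listRead {d | d ∈ L} w p.1 p.2 := by
  obtain ⟨d, w'⟩ := p
  cases w with
  | nil => simp [wordReads, listRead, eq_comm]
  | cons a w => simp [wordReads, listRead]

/-- A formula with its stack, the values of the data variables, and the remaining word. -/
abbrev Config := (Formula × RecStack) × List ℕ × List ℕ

open Classical in
/-- The successors of a configuration, with the values `A` for quantifiers and the letters `L`
past the end of the word. -/
noncomputable def Config.next (A L : List ℕ) : Config → List Config
  | ((.dia b ψ, σ), l, w) => (wordReads L w).flatMap fun p =>
      if b.Sat (envVal l) p.1 then [((ψ, σ), l, p.2)] else []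
  | ((.ex x ψ, σ), l, w) => A.map fun d => ((ψ, σ), envSet l x d, w)
  | c => (control c.1).map fun k => (k, c.2)

/-- Reachability of configurations. -/
def Config.Reaches (A L : List ℕ) : Config → Config → Prop :=
  Relation.ReflTransGen fun c c' => c' ∈ c.next A L

theorem Run.exists_reaches {A L : List ℕ} {ψ : Formula} {σ : RecStack} {η : ℕ → Option ℕ}
    {w : List ℕ} (h : Run {d | d ∈ A} (listRead {d | d ∈ L}) ψ σ η w) {l : List ℕ}
    (hl : η = envVal l) : ∃ c, Config.Reaches A L ((ψ, σ), l, w) c ∧ c.1.1 = .tt := by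
  have step {c c' : Config} (hc : c' ∈ c.next A L)
      (h : ∃ c'', Config.Reaches A L c' c'' ∧ c''.1.1 = .tt) :
      ∃ c'', Config.Reaches A L c c'' ∧ c''.1.1 = .tt :=
    h.imp fun c'' => And.imp_left (Relation.ReflTransGen.head hc)
  induction h generalizing l with
  | tt => exact ⟨_, .refl, rfl⟩
  | dia d s' hr hb h ih =>
    subst hl
    refine step ?_ (ih rfl)
    exact List.mem_flatMap.2 ⟨(d, s'), mem_wordReads.2 hr, by simp [hb]⟩
  | ex d hd h ih =>
    subst hl
    exact step (List.mem_map.2 ⟨d, hd, rfl⟩) (ih (envVal_envSet _ _ _).symm)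
  | orl h ih => exact step (by simp [Config.next, control]) (ih hl)
  | orr h ih => exact step (by simp [Config.next, control]) (ih hl)
  | lfp h ih => exact step (by simp [Config.next, control]) (ih hl)
  | hit h ih => exact step (by simp [Config.next, control]) (ih hl)
  | miss hXY h ih => exact step (by simp [Config.next, control, hXY.symm]) (ih hl)

theorem Run.of_next {A L : List ℕ} {c c' : Config} (hc : c' ∈ c.next A L)
    (h : Run {d | d ∈ A} (listRead {d | d ∈ L}) c'.1.1 c'.1.2 (envVal c'.2.1) c'.2.2) :
    Run {d | d ∈ A} (listRead {d | d ∈ L}) c.1.1 c.1.2 (envVal c.2.1) c.2.2 := by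
  obtain ⟨⟨ψ, σ⟩, l, w⟩ := c
  cases ψ with
  | dia b ψ =>
    obtain ⟨p, hp, hc⟩ := List.mem_flatMap.1 hc
    split_ifs at hc with hb
    · obtain rfl := List.mem_singleton.1 hc
      exact .dia p.1 p.2 (mem_wordReads.1 hp) hb h
    · simp at hc
  | ex x ψ =>
    obtain ⟨d, hd, rfl⟩ := List.mem_map.1 hc
    refine .ex d hd ?_
    rw [← envVal_envSet]
    exact h
  | or ψ χ =>
    simp only [Config.next, control, List.map_cons, List.map_nil, List.mem_cons,
      List.not_mem_nil, or_false] at hc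
    rcases hc with rfl | rfl
    · exact .orl h
    · exact .orr h
  | lfp X ψ =>
    simp only [Config.next, control, List.map_cons, List.map_nil, List.mem_singleton] at hc
    subst hc
    exact .lfp h
  | fvar X =>
    cases σ with
    | nil => simp [Config.next, control] at hc
    | cons q σ =>
      obtain ⟨Y, β⟩ := q
      by_cases hXY : Y = X
      · subst hXY
        simp only [Config.next, control, if_pos, List.map_cons, List.map_nil,
          List.mem_singleton] at hc
        subst hc
        exact .hit h
      · simp only [Config.next, control, if_neg hXY, List.map_cons, List.map_nil,
          List.mem_singleton] at hc
        subst hc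
        exact .miss (Ne.symm hXY) h
  | _ => simp [Config.next, control] at hc

theorem run_iff_exists_reaches {A L : List ℕ} {ψ : Formula} {σ : RecStack} {l w : List ℕ} :
    Run {d | d ∈ A} (listRead {d | d ∈ L}) ψ σ (envVal l) w ↔
      ∃ c, Config.Reaches A L ((ψ, σ), l, w) c ∧ c.1.1 = .tt := by
  refine ⟨fun h => h.exists_reaches rfl, ?_⟩
  rintro ⟨⟨⟨ψ', σ'⟩, l', w'⟩, h, rfl : ψ' = .tt⟩
  suffices ∀ c : Config, Config.Reaches A L c ((.tt, σ'), l', w') →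
      Run {d | d ∈ A} (listRead {d | d ∈ L}) c.1.1 c.1.2 (envVal c.2.1) c.2.2 from
    this _ h
  intro c hc
  induction hc using Relation.ReflTransGen.head_induction_on with
  | refl => exact .tt
  | head hc _ ih => exact Run.of_next hc ih

/-! ## Finiteness of the set of reachable configurations -/

/-- The control points reachable from a formula, apart from those of the stack. -/
def controlClosure : Formula → RecStack → Set (Formula × RecStack)
  | .dia b ψ, σ => insert (.dia b ψ, σ) (controlClosure ψ σ)
  | .ex x ψ, σ => insert (.ex x ψ, σ) (controlClosure ψ σ)
  | .or ψ χ, σ => insert (.or ψ χ, σ) (controlClosure ψ σ ∪ controlClosure χ σ)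
  | .lfp X ψ, σ => insert (.lfp X ψ, σ) (controlClosure ψ ((X, ψ) :: σ))
  | .fvar X, σ => (fun τ => (.fvar X, τ)) '' {τ | τ <:+ σ}
  | φ, σ => {(φ, σ)}

theorem finite_setOf_suffix {α : Type*} (l : List α) : {τ | τ <:+ l}.Finite :=
  (List.finite_toSet l.tails).subset fun _ h => (List.mem_tails _ _).2 h

theorem finite_controlClosure (φ : Formula) (σ : RecStack) : (controlClosure φ σ).Finite := by
  induction φ generalizing σ with
  | dia b ψ ih => exact (ih σ).insert _
  | ex x ψ ih => exact (ih σ).insert _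
  | or ψ χ ih₁ ih₂ => exact ((ih₁ σ).union (ih₂ σ)).insert _
  | lfp X ψ ih => exact (ih _).insert _
  | fvar X => exact (finite_setOf_suffix σ).image _
  | _ => exact Set.finite_singleton _

theorem mem_controlClosure (φ : Formula) (σ : RecStack) : (φ, σ) ∈ controlClosure φ σ := by
  cases φ <;> simp [controlClosure]

/-- Codes dominate the codes of their components, so the code of the formula bounds the names of its
quantified variables. -/
theorem code_le_of_mem_controlClosure {φ : Formula} {σ : RecStack} {c : Formula × RecStack}
    (h : c ∈ controlClosure φ σ) : c.1.code ≤ φ.code := by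
  have pr (a b c : ℕ) : c ≤ Nat.pair a (Nat.pair b c) :=
    (Nat.right_le_pair b c).trans (Nat.right_le_pair a _)
  have pl (a b c : ℕ) : b ≤ Nat.pair a (Nat.pair b c) :=
    (Nat.left_le_pair b c).trans (Nat.right_le_pair a _)
  induction φ generalizing σ with
  | dia b ψ ih =>
    rcases h with rfl | h
    · exact le_rfl
    · exact (ih h).trans (pr _ _ _)
  | ex x ψ ih =>
    rcases h with rfl | h
    · exact le_rfl
    · exact (ih h).trans (pr _ _ _)
  | or ψ χ ih₁ ih₂ =>
    rcases h with rfl | h | h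
    · exact le_rfl
    · exact (ih₁ h).trans (pl _ _ _)
    · exact (ih₂ h).trans (pr _ _ _)
  | lfp X ψ ih =>
    rcases h with rfl | h
    · exact le_rfl
    · exact (ih h).trans (pr _ _ _)
  | fvar X =>
    obtain ⟨τ, -, rfl⟩ := h
    exact le_rfl
  | _ =>
    obtain rfl := Set.mem_singleton_iff.1 h
    exact le_rfl

/-- Only a jump through a recursion variable leaves the closure of the current formula. It lands in
a body on the stack, which `hσ` covers; when a binder is pushed, the new top body is the subformula
being entered. -/
theorem control_mem_of_controlClosure_subset {U : Set (Formula × RecStack)} {φ : Formula}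
    {σ : RecStack} (hφ : controlClosure φ σ ⊆ U)
    (hσ : ∀ X β τ, (X, β) :: τ <:+ σ → controlClosure β ((X, β) :: τ) ⊆ U)
    {c c' : Formula × RecStack} (hc : c ∈ controlClosure φ σ) (hc' : c' ∈ control c) : c' ∈ U := by
  induction φ generalizing σ with
  | dia b ψ ih =>
    have hψ := (Set.subset_insert _ _).trans hφ
    rcases hc with rfl | hc
    · obtain rfl := List.mem_singleton.1 hc'
      exact hψ (mem_controlClosure _ _)
    · exact ih hψ hσ hc
  | ex x ψ ih =>
    have hψ := (Set.subset_insert _ _).trans hφ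
    rcases hc with rfl | hc
    · obtain rfl := List.mem_singleton.1 hc'
      exact hψ (mem_controlClosure _ _)
    · exact ih hψ hσ hc
  | or ψ χ ih₁ ih₂ =>
    have h := Set.union_subset_iff.1 ((Set.subset_insert _ _).trans hφ)
    rcases hc with rfl | hc | hc
    · simp only [control, List.mem_cons, List.not_mem_nil, or_false] at hc'
      rcases hc' with rfl | rfl
      · exact h.1 (mem_controlClosure _ _)
      · exact h.2 (mem_controlClosure _ _)
    · exact ih₁ h.1 hσ hc
    · exact ih₂ h.2 hσ hc
  | lfp X ψ ih =>
    have hψ := (Set.subset_insert _ _).trans hφ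
    rcases hc with rfl | hc
    · obtain rfl := List.mem_singleton.1 hc'
      exact hψ (mem_controlClosure _ _)
    · refine ih hψ (fun Y β τ hτ => ?_) hc
      rcases List.suffix_cons_iff.1 hτ with h | h
      · simp only [List.cons.injEq, Prod.mk.injEq] at h
        obtain ⟨⟨rfl, rfl⟩, rfl⟩ := h
        exact hψ
      · exact hσ Y β τ h
  | fvar X =>
    obtain ⟨τ, hτ, rfl⟩ := hc
    rcases τ with _ | ⟨⟨Y, β⟩, τ⟩
    · simp [control] at hc'
    · by_cases hY : Y = X
      · simp only [control, if_pos hY, List.mem_singleton] at hc'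
        subst hc'
        exact hσ Y β τ hτ (mem_controlClosure _ _)
      · simp only [control, if_neg hY, List.mem_singleton] at hc'
        subst hc'
        exact hφ ⟨τ, (List.suffix_cons _ _).trans hτ, rfl⟩
  | _ =>
    obtain rfl := Set.mem_singleton_iff.1 hc
    simp [control] at hc'

theorem controlClosed_controlClosure (φ : Formula) :
    ControlClosed (controlClosure φ []) (φ.code + 1) where
  mem_of_control _ hc _ hc' := by
    refine control_mem_of_controlClosure_subset le_rfl (fun X β τ h => ?_) hc hc'
    simp at h
  lt_of_ex x ψ σ h := by
    refine Nat.lt_succ_of_le (le_trans ?_ (code_le_of_mem_controlClosure h))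
    exact (Nat.left_le_pair x ψ.code).trans (Nat.right_le_pair 5 _)

theorem finite_setOf_length_le_and_le (n m : ℕ) :
    {l : List ℕ | l.length ≤ n ∧ ∀ x ∈ l, x ≤ m}.Finite := by
  refine ((List.finite_length_le (Fin (m + 1)) n).image (List.map Fin.val)).subset ?_
  rintro l ⟨hl, hm⟩
  refine ⟨l.pmap (fun x hx => ⟨x, Nat.lt_succ_of_le hx⟩) hm, by simpa using hl, ?_⟩
  simp [List.map_pmap]

theorem finite_setOf_reaches (A L : List ℕ) (φ : Formula) (w : List ℕ) :
    {c | Config.Reaches A L ((φ, []), [], w) c}.Finite := by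
  have hU := controlClosed_controlClosure φ
  -- Environment entries are `0` or `d + 1` with `d ∈ A`.
  obtain ⟨m, hm⟩ : ∃ m, ∀ d ∈ A, d + 1 ≤ m := by
    refine ⟨A.sum + 1, fun d hd => Nat.succ_le_succ ?_⟩
    exact List.single_le_sum (fun _ _ => Nat.zero_le _) d hd
  refine ((finite_controlClosure φ []).prod ((finite_setOf_length_le_and_le (φ.code + 1) m).prod
    (finite_setOf_suffix w))).subset ?_
  intro c hc
  induction hc with
  | refl => exact ⟨mem_controlClosure _ _, by simp, List.suffix_refl _⟩
  | @tail c c' _ h ih =>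
    obtain ⟨⟨ψ, σ⟩, l, v⟩ := c
    obtain ⟨hψ, ⟨hl, hlm⟩, hv⟩ := ih
    have other (h : c' ∈ (control (ψ, σ)).map fun k => (k, l, v)) :
        c' ∈ controlClosure φ [] ×ˢ {l : List ℕ | l.length ≤ φ.code + 1 ∧ ∀ x ∈ l, x ≤ m} ×ˢ
          {τ | τ <:+ w} := by
      obtain ⟨k, hk, rfl⟩ := List.mem_map.1 h
      exact ⟨hU.mem_of_control _ hψ _ hk, ⟨hl, hlm⟩, hv⟩
    cases ψ with
    | dia b ψ =>
      obtain ⟨p, hp, hc⟩ := List.mem_flatMap.1 h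
      split_ifs at hc with hb
      · obtain rfl := List.mem_singleton.1 hc
        refine ⟨hU.mem_of_control _ hψ _ (by simp [control]), ⟨hl, hlm⟩, ?_⟩
        have hr := mem_wordReads.1 hp
        cases v with
        | nil => exact hr.2 ▸ List.nil_suffix
        | cons a v => exact hr.2 ▸ (List.suffix_cons _ _).trans hv
      · simp at hc
    | ex x ψ =>
      obtain ⟨d, hd, rfl⟩ := List.mem_map.1 h
      refine ⟨hU.mem_of_control _ hψ _ (by simp [control]), ⟨?_, ?_⟩, hv⟩
      · have := hU.lt_of_ex x ψ σ hψ
        simp only [envSet, List.length_map, List.length_range]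
        exact max_le hl this
      · intro y hy
        obtain ⟨z, -, rfl⟩ := List.mem_map.1 hy
        split_ifs
        · exact hm d hd
        · by_cases hz : z < l.length
          · rw [List.getD_eq_getElem _ _ hz]
            exact hlm _ (List.getElem_mem hz)
          · rw [List.getD_eq_default _ _ (not_lt.1 hz)]
            exact Nat.zero_le _
    | _ => exact other h

/-! ## Saturation -/

section Saturation

variable {α : Type*}

/-- The elements reachable in at most `n` steps. -/
def reachedList (next : α → List α) (a : α) (n : ℕ) : List α :=
  Nat.rec [a] (fun _ l => l ++ l.flatMap next) n

theorem mem_reachedList_succ {next : α → List α} {a b : α} {n : ℕ} :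
    b ∈ reachedList next a (n + 1) ↔
      b ∈ reachedList next a n ∨ ∃ c ∈ reachedList next a n, b ∈ next c := by
  change b ∈ reachedList next a n ++ (reachedList next a n).flatMap next ↔ _
  rw [List.mem_append, List.mem_flatMap]

theorem reflTransGen_of_mem_reachedList {next : α → List α} {a b : α} {n : ℕ}
    (h : b ∈ reachedList next a n) : Relation.ReflTransGen (fun c c' => c' ∈ next c) a b := by
  induction n generalizing b with
  | zero => rw [List.mem_singleton.1 h]
  | succ n ih =>
    rcases mem_reachedList_succ.1 h with h | ⟨c, hc, hb⟩
    · exact ih h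
    · exact (ih hc).tail hb

/-- A list to which one round adds no new element is closed under successors. -/
theorem mem_reachedList_iff {next : α → List α} {a b : α} {n : ℕ}
    (hn : ∀ c ∈ reachedList next a (n + 1), c ∈ reachedList next a n) :
    b ∈ reachedList next a n ↔ Relation.ReflTransGen (fun c c' => c' ∈ next c) a b := by
  refine ⟨reflTransGen_of_mem_reachedList, fun h => ?_⟩
  induction h with
  | refl =>
    clear hn
    induction n with
    | zero => exact List.mem_singleton_self a
    | succ n ih => exact mem_reachedList_succ.2 (Or.inl ih)
  | tail _ h ih => exact hn _ (mem_reachedList_succ.2 (Or.inr ⟨_, ih, h⟩))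

theorem reachedList_mono {next : α → List α} {a : α} {m n : ℕ} (hmn : m ≤ n) :
    reachedList next a m ⊆ reachedList next a n := by
  induction hmn with
  | refl => exact fun _ h => h
  | step _ ih => exact fun _ h => mem_reachedList_succ.2 (Or.inl (ih h))

theorem saturated_mono {next : α → List α} {a : α} {m n : ℕ} (hmn : m ≤ n)
    (hm : ∀ c ∈ reachedList next a (m + 1), c ∈ reachedList next a m) :
    ∀ c ∈ reachedList next a (n + 1), c ∈ reachedList next a n := fun _ h =>
  reachedList_mono hmn ((mem_reachedList_iff hm).2 (reflTransGen_of_mem_reachedList h))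

theorem exists_saturated {next : α → List α} {a : α}
    (h : {b | Relation.ReflTransGen (fun c c' => c' ∈ next c) a b}.Finite) :
    ∃ n, ∀ c ∈ reachedList next a (n + 1), c ∈ reachedList next a n := by
  classical
  by_contra! hne
  have hmono : StrictMono fun n => (reachedList next a n).toFinset.card := by
    refine strictMono_nat_of_lt_succ fun n => Finset.card_lt_card ?_
    obtain ⟨c, hc, hc'⟩ := hne n
    refine Finset.ssubset_iff_subset_ne.2 ⟨fun b hb => ?_, fun heq => hc' ?_⟩
    · exact List.mem_toFinset.2 (reachedList_mono n.le_succ (List.mem_toFinset.1 hb))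
    · rw [← List.mem_toFinset, heq, List.mem_toFinset]
      exact hc
  have hle : (reachedList next a (h.toFinset.card + 1)).toFinset.card ≤ h.toFinset.card :=
    Finset.card_le_card fun b hb =>
      h.mem_toFinset.2 (reflTransGen_of_mem_reachedList (List.mem_toFinset.1 hb))
  -- A strictly increasing sequence of naturals dominates its index, here one more than the number
  -- of reachable elements.
  have := hmono.le_apply (x := h.toFinset.card + 1)
  omega

end Saturation

/-! ## Configurations as tuples of codes -/

/-- Value of the expression with code `e`. -/
def valueCode (l : List ℕ) (d e : ℕ) : ℕ :=
  Nat.casesOn e (d + 1) fun x => l.getD x 0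

theorem unpair_snd_lt {n : ℕ} (h : 1 ≤ n.unpair.1) : n.unpair.2 < n := by
  conv_rhs => rw [← Nat.pair_unpair n]
  have := Nat.add_le_pair n.unpair.1 n.unpair.2
  omega

/-- Truth of the constraint with code `b`. -/
def satCode (l : List ℕ) (d : ℕ) (b : ℕ) : Bool :=
  if b.unpair.1 = 2 then
    decide (valueCode l d b.unpair.2.unpair.1 = valueCode l d b.unpair.2.unpair.2)
  else if h : b.unpair.1 = 3 then
    have : b.unpair.2 < b := unpair_snd_lt (by omega)
    !satCode l d b.unpair.2
  else if h : b.unpair.1 = 4 then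
    have h₁ : b.unpair.2.unpair.1 < b :=
      (Nat.unpair_left_le _).trans_lt (unpair_snd_lt (by omega))
    have h₂ : b.unpair.2.unpair.2 < b :=
      (Nat.unpair_right_le _).trans_lt (unpair_snd_lt (by omega))
    satCode l d b.unpair.2.unpair.1 && satCode l d b.unpair.2.unpair.2
  else true
termination_by b

/-- Values are shifted by one, with `0` for an unassigned variable, so equality of numbers is
equality in `Option ℕ`. -/
theorem valueCode_code (l : List ℕ) (d : ℕ) (e : DExp) :
    valueCode l d e.code = ((e.value (envVal l) d).elim 0 Nat.succ) := by
  cases e with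
  | star => rfl
  | var x =>
    change l.getD x 0 = (envVal l x).elim 0 Nat.succ
    rw [envVal]
    cases l.getD x 0 <;> rfl

theorem satCode_code (l : List ℕ) (d : ℕ) (b : BExp) :
    satCode l d b.code = true ↔ b.Sat (envVal l) d := by
  have inj : Function.Injective fun o : Option ℕ => o.elim 0 Nat.succ := by
    rintro (_ | _) (_ | _) h <;> simp_all
  induction b with
  | tru => rw [satCode]; simp [BExp.code, BExp.Sat]
  | eq e f =>
    rw [satCode]
    simp only [BExp.code, Nat.unpair_pair, if_true, decide_eq_true_eq, valueCode_code, BExp.Sat]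
    exact inj.eq_iff
  | not b ih =>
    rw [satCode]
    simp [BExp.code, BExp.Sat, ← ih]
  | and b c ihb ihc =>
    rw [satCode]
    simp [BExp.code, BExp.Sat, ← ihb, ← ihc]

/-- The control successors at the level of codes. -/
def controlCode (k : ℕ × List ℕ) : List (ℕ × List ℕ) :=
  if k.1.unpair.1 = 7 then
    [(k.1.unpair.2.unpair.1, k.2), (k.1.unpair.2.unpair.2, k.2)]
  else if k.1.unpair.1 = 9 then [(k.1.unpair.2.unpair.2, k.1.unpair.2 :: k.2)]
  else if k.1.unpair.1 = 11 then
    List.casesOn k.2 [] fun q τ =>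
      if q.unpair.1 = k.1.unpair.2 then [(q.unpair.2, k.2)] else [(k.1, τ)]
  else []

/-- Configurations with codes in place of formulas. -/
abbrev CodeConfig := (ℕ × List ℕ) × List ℕ × List ℕ

/-- The successors of a configuration at the level of codes. -/
def CodeConfig.next (p : List ℕ × List ℕ) (c : CodeConfig) : List CodeConfig :=
  if c.1.1.unpair.1 = 3 then
    (wordReads p.2 c.2.2).flatMap fun r =>
      if satCode c.2.1 r.1 c.1.1.unpair.2.unpair.1 = true then
        [((c.1.1.unpair.2.unpair.2, c.1.2), c.2.1, r.2)] else []
  else if c.1.1.unpair.1 = 5 then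
    p.1.map fun d =>
      ((c.1.1.unpair.2.unpair.2, c.1.2), envSet c.2.1 c.1.1.unpair.2.unpair.1 d, c.2.2)
  else (controlCode c.1).map fun k => (k, c.2)

/-- The codes of a control point. -/
def encodeControl (c : Formula × RecStack) : ℕ × List ℕ :=
  (c.1.code, c.2.map fun q => Nat.pair q.1 q.2.code)

/-- The codes of a configuration. -/
def Config.toCode (c : Config) : CodeConfig := (encodeControl c.1, c.2)

theorem controlCode_encodeControl (c : Formula × RecStack) (hd : ∀ b ψ, c.1 ≠ .dia b ψ)
    (hx : ∀ x ψ, c.1 ≠ .ex x ψ) :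
    controlCode (encodeControl c) = (control c).map encodeControl := by
  obtain ⟨ψ, σ⟩ := c
  cases ψ with
  | dia b ψ => exact (hd _ _ rfl).elim
  | ex x ψ => exact (hx _ _ rfl).elim
  | fvar X =>
    rcases σ with _ | ⟨⟨Y, β⟩, σ⟩
    · simp [controlCode, encodeControl, control, Formula.code]
    · by_cases h : Y = X <;> simp [controlCode, encodeControl, control, Formula.code, h]
  | _ => simp [controlCode, encodeControl, control, Formula.code]

theorem Config.next_toCode (A L : List ℕ) (c : Config) :
    c.toCode.next (A, L) = (c.next A L).map Config.toCode := by
  have other (c : Config) (hd : ∀ b ψ, c.1.1 ≠ .dia b ψ) (hx : ∀ x ψ, c.1.1 ≠ .ex x ψ)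
      (h3 : c.1.1.code.unpair.1 ≠ 3) (h5 : c.1.1.code.unpair.1 ≠ 5)
      (hn : c.next A L = (control c.1).map fun k => (k, c.2)) :
      c.toCode.next (A, L) = (c.next A L).map Config.toCode := by
    change c.toCode.1.1.unpair.1 ≠ 3 at h3
    change c.toCode.1.1.unpair.1 ≠ 5 at h5
    rw [hn, CodeConfig.next, if_neg h3, if_neg h5]
    change (controlCode (encodeControl c.1)).map _ = _
    rw [controlCode_encodeControl _ hd hx, List.map_map, List.map_map]
    rfl
  obtain ⟨⟨ψ, σ⟩, l, w⟩ := c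
  cases ψ with
  | dia b ψ =>
    simp only [Config.toCode, encodeControl, CodeConfig.next, Formula.code, Nat.unpair_pair,
      if_true, Config.next, List.map_flatMap]
    congr 1
    funext r
    by_cases h : b.Sat (envVal l) r.1
    · simp only [satCode_code, h, if_true]
      rfl
    · simp [satCode_code, h]
  | ex x ψ =>
    simp [Config.toCode, encodeControl, CodeConfig.next, Formula.code, Config.next]
  | _ =>
    exact other _ (by simp) (by simp) (by simp [Formula.code]) (by simp [Formula.code]) rfl

/-- Reachability at the level of codes. -/
def CodeConfig.Reaches (p : List ℕ × List ℕ) : CodeConfig → CodeConfig → Prop :=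
  Relation.ReflTransGen fun c c' => c' ∈ c.next p

/-- Successors commute with coding exactly, so every code reached from a coded configuration is
itself the code of a reachable one. No decoding is needed. -/
theorem Config.reaches_toCode_iff {A L : List ℕ} {c : Config} {e : CodeConfig} :
    CodeConfig.Reaches (A, L) c.toCode e ↔ ∃ c', Config.Reaches A L c c' ∧ c'.toCode = e := by
  constructor
  · intro h
    induction h with
    | refl => exact ⟨c, .refl, rfl⟩
    | tail _ h ih =>
      obtain ⟨c', hc', rfl⟩ := ih
      rw [Config.next_toCode] at h
      obtain ⟨c'', hc'', rfl⟩ := List.mem_map.1 h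
      exact ⟨c'', hc'.tail hc'', rfl⟩
  · rintro ⟨c', h, rfl⟩
    refine h.lift Config.toCode fun a b hab => ?_
    change b.toCode ∈ a.toCode.next (A, L)
    rw [Config.next_toCode]
    exact List.mem_map_of_mem hab

theorem Formula.code_eq_tt_iff {φ : Formula} : φ.code = Nat.pair 1 0 ↔ φ = .tt := by
  cases φ <;> simp [Formula.code, Nat.pair_eq_pair]

/-- The initial configuration for the formula with code `n` and the word `w`. -/
def CodeConfig.initial (n : ℕ) (w : List ℕ) : CodeConfig := ((n, []), [], w)

theorem run_iff_codeReaches {A L : List ℕ} {φ : Formula} {w : List ℕ} :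
    Run {d | d ∈ A} (listRead {d | d ∈ L}) φ [] (fun _ => none) w ↔
      ∃ e, CodeConfig.Reaches (A, L) (.initial φ.code w) e ∧ e.1.1 = Nat.pair 1 0 := by
  have h0 : (fun _ => none) = envVal [] := rfl
  rw [h0, run_iff_exists_reaches]
  constructor
  · rintro ⟨c, hc, htt⟩
    exact ⟨c.toCode, Config.reaches_toCode_iff.2 ⟨c, hc, rfl⟩, Formula.code_eq_tt_iff.2 htt⟩
  · rintro ⟨e, he, htt⟩
    obtain ⟨c, hc, rfl⟩ := Config.reaches_toCode_iff.1
      (show CodeConfig.Reaches (A, L) (Config.toCode ((φ, []), [], w)) e from he)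
    exact ⟨c, hc, Formula.code_eq_tt_iff.1 htt⟩

theorem finite_setOf_codeReaches (A L : List ℕ) (φ : Formula) (w : List ℕ) :
    {e | CodeConfig.Reaches (A, L) (.initial φ.code w) e}.Finite := by
  refine ((finite_setOf_reaches A L φ w).image Config.toCode).subset fun e he => ?_
  exact Config.reaches_toCode_iff.1
    (show CodeConfig.Reaches (A, L) (Config.toCode ((φ, []), [], w)) e from he)

/-! ## The verdict procedure -/

/-- Sufficiently many values for the formula with code `n` and the word `w`. -/
def valuePool (n : ℕ) (w : List ℕ) : List ℕ := w ++ List.range (w.length + n + 2)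

/-- This is the bound required by `Run.map_into_finset` with `N = n + 1` and `k = w.length`. -/
theorem card_valuePool (n : ℕ) (w : List ℕ) : n + 1 + w.length < (valuePool n w).toFinset.card := by
  have : (Finset.range (w.length + n + 2)).card ≤ (valuePool n w).toFinset.card :=
    Finset.card_le_card fun x hx => by
      simp only [valuePool, List.mem_toFinset, List.mem_append, List.mem_range]
      exact Or.inr (Finset.mem_range.1 hx)
  rw [Finset.card_range] at this
  omega

/-- The configurations reachable in `k` steps; letters past the end of the word are read only
if `ext` is true. -/
def explored (ext : Bool) (i : ℕ × List ℕ) (k : ℕ) : List CodeConfig :=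
  reachedList (CodeConfig.next (valuePool i.1 i.2, bif ext then valuePool i.1 i.2 else []))
    (.initial i.1 i.2) k

/-- The exploration is complete after `k` steps. -/
def Saturated (ext : Bool) (i : ℕ × List ℕ) (k : ℕ) : Prop :=
  ∀ c ∈ explored ext i (k + 1), c ∈ explored ext i k

/-- An accepting configuration is found within `k` steps. -/
def Found (ext : Bool) (i : ℕ × List ℕ) (k : ℕ) : Prop :=
  ∃ c ∈ explored ext i k, c.1.1 = Nat.pair 1 0

theorem exists_saturated_explored (φ : Formula) (w : List ℕ) :
    ∃ k, ∀ ext, Saturated ext (φ.code, w) k := by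
  have h (ext : Bool) : ∃ k, Saturated ext (φ.code, w) k :=
    exists_saturated (finite_setOf_codeReaches _ _ φ w)
  choose k hk using h
  exact ⟨max (k true) (k false), fun ext =>
    saturated_mono (by cases ext <;> simp) (hk ext)⟩

theorem found_iff_run {ext : Bool} {φ : Formula} {w : List ℕ} {k : ℕ}
    (hk : Saturated ext (φ.code, w) k) : Found ext (φ.code, w) k ↔
      Run {d | d ∈ valuePool φ.code w}
        (listRead {d | d ∈ bif ext then valuePool φ.code w else []}) φ [] (fun _ => none) w := by
  rw [run_iff_codeReaches]
  exact exists_congr fun c => and_congr_left' (mem_reachedList_iff hk)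

section Transfer

variable {D : Type*} [Encodable D] [Infinite D]

/-- Runs over `D` move into the pool by `Run.map_into_finset`. Conversely a run over the pool is
pulled back along a bijection. -/
theorem run_encode_iff {ext : Bool} {φ : Formula} {w : List D} :
    Run {d | d ∈ valuePool φ.code (w.map Encodable.encode)}
        (listRead {d | d ∈ bif ext then valuePool φ.code (w.map Encodable.encode) else []})
        φ [] (fun _ => none) (w.map Encodable.encode) ↔
      Run Set.univ (listRead (bif ext then Set.univ else ∅ : Set D)) φ [] (fun _ => none) w := by
  constructor
  · intro h
    have := Denumerable.ofEncodableOfInfinite D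
    -- `encode` need not be onto, and pool values may encode nothing in `D`; a bijection agreeing
    -- with it on `w` can be inverted.
    obtain ⟨e, he⟩ := exists_equiv_eq_on_list (Denumerable.eqv D) (Encodable.encode_injective) w
    have hm := h.map (V' := Set.univ) (L' := (bif ext then Set.univ else ∅ : Set D))
      e.symm.injective (Set.mapsTo_univ _ _) (by cases ext <;> simp [Set.MapsTo])
    have hw : (w.map Encodable.encode).map e.symm = w := by
      rw [← List.map_congr_left he, List.map_map, e.symm_comp_self, List.map_id]
    rwa [hw] at hm
  · intro h
    have := h.map_into_finset (controlClosed_controlClosure φ)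
      (L' := {d | d ∈ bif ext then valuePool φ.code (w.map Encodable.encode) else []})
      (card_valuePool φ.code (w.map Encodable.encode)) (by cases ext <;> simp)
      (Encodable.encode_injective) (by simp)
      (fun d hd => by
        rw [List.mem_toFinset]
        exact List.mem_append_left _ (List.mem_map_of_mem hd))
      (by simp) (mem_controlClosure _ _)
    simpa using this

end Transfer

/-! ## Computability -/

section Computability

open Primrec

theorem primrec_envSet : Primrec fun a : List ℕ × ℕ × ℕ => envSet a.1 a.2.1 a.2.2 := by
  refine list_map (list_range.comp (nat_max.comp (list_length.comp fst)
    (succ.comp (fst.comp snd)))) ?_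
  refine Primrec.ite (Primrec.eq.comp snd (fst.comp (snd.comp fst)))
    (succ.comp (snd.comp (snd.comp fst))) ?_
  exact (list_getD 0).comp (fst.comp fst) snd

theorem primrec_wordReads : Primrec₂ wordReads := by
  have hL : Primrec₂ fun (_ : List ℕ × List ℕ) (d : ℕ) => (d, ([] : List ℕ)) :=
    pair snd (const [])
  have hw : Primrec₂ fun (_ : List ℕ × List ℕ) (x : ℕ × List ℕ) => [x] :=
    list_cons.comp snd (const [])
  exact list_casesOn snd (list_map fst hL) hw

theorem primrec_valueCode : Primrec fun a : (List ℕ × ℕ) × ℕ => valueCode a.1.1 a.1.2 a.2 := by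
  refine nat_casesOn snd (succ.comp (snd.comp fst)) ?_
  exact (list_getD 0).comp (fst.comp (fst.comp fst)) snd

/-- Course-of-values recursion: `r` lists the truth values of all smaller codes, so `r.length` is
the current code. The default `true` is never reached, since components have smaller codes. -/
theorem primrec_satCode : Primrec₂ fun (a : List ℕ × ℕ) b => satCode a.1 a.2 b := by
  let g (a : List ℕ × ℕ) (r : List Bool) : Option Bool :=
    some <| if r.length.unpair.1 = 2 then
      decide (valueCode a.1 a.2 r.length.unpair.2.unpair.1 =
        valueCode a.1 a.2 r.length.unpair.2.unpair.2)
    else if r.length.unpair.1 = 3 then !(r.getD r.length.unpair.2 true)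
    else if r.length.unpair.1 = 4 then
      r.getD r.length.unpair.2.unpair.1 true && r.getD r.length.unpair.2.unpair.2 true
    else true
  have hn : Primrec fun x : (List ℕ × ℕ) × List Bool => x.2.length.unpair :=
    unpair.comp (list_length.comp snd)
  have hp : Primrec fun x : (List ℕ × ℕ) × List Bool => x.2.length.unpair.2.unpair :=
    unpair.comp (snd.comp hn)
  have hg : Primrec₂ g := by
    refine option_some.comp ?_
    refine Primrec.ite (Primrec.eq.comp (fst.comp hn) (const 2)) ?_ ?_
    · exact PrimrecPred.decide (Primrec.eq.comp
        (primrec_valueCode.comp (pair fst (fst.comp hp)))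
        (primrec_valueCode.comp (pair fst (snd.comp hp))))
    refine Primrec.ite (Primrec.eq.comp (fst.comp hn) (const 3)) ?_ ?_
    · exact Primrec.not.comp ((list_getD true).comp snd (snd.comp hn))
    refine Primrec.ite (Primrec.eq.comp (fst.comp hn) (const 4)) ?_ (const true)
    exact Primrec.and.comp ((list_getD true).comp snd (fst.comp hp))
      ((list_getD true).comp snd (snd.comp hp))
  refine nat_strong_rec _ hg fun a n => ?_
  have get {m : ℕ} (hm : m < n) :
      ((List.range n).map (satCode a.1 a.2)).getD m true = satCode a.1 a.2 m := by
    simp [List.getD_eq_getElem?_getD, hm]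
  simp only [g, List.length_map, List.length_range, Option.some_inj]
  rw [satCode]
  split_ifs with h2 h3 h4
  · rfl
  · rw [get (unpair_snd_lt (by omega))]
  · rw [get ((Nat.unpair_left_le _).trans_lt (unpair_snd_lt (by omega))),
      get ((Nat.unpair_right_le _).trans_lt (unpair_snd_lt (by omega)))]
  · rfl

theorem primrec_controlCode : Primrec controlCode := by
  have hn : Primrec fun k : ℕ × List ℕ => k.1.unpair := unpair.comp fst
  have hp : Primrec fun k : ℕ × List ℕ => k.1.unpair.2.unpair := unpair.comp (snd.comp hn)
  have single {α β : Type} [Primcodable α] [Primcodable β] {f : α → β} (hf : Primrec f) :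
      Primrec fun a => [f a] := list_cons.comp hf (const [])
  refine Primrec.ite (Primrec.eq.comp (fst.comp hn) (const 7)) ?_ ?_
  · exact list_cons.comp (pair (fst.comp hp) snd) (single (pair (snd.comp hp) snd))
  refine Primrec.ite (Primrec.eq.comp (fst.comp hn) (const 9)) ?_ ?_
  · exact single (pair (snd.comp hp) (list_cons.comp (snd.comp hn) snd))
  refine Primrec.ite (Primrec.eq.comp (fst.comp hn) (const 11)) ?_ (const [])
  have hq : Primrec fun x : (ℕ × List ℕ) × ℕ × List ℕ => x.2.1.unpair :=
    unpair.comp (fst.comp snd)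
  have hcons : Primrec₂ fun (k : ℕ × List ℕ) (x : ℕ × List ℕ) =>
      if x.1.unpair.1 = k.1.unpair.2 then [(x.1.unpair.2, k.2)] else [(k.1, x.2)] :=
    Primrec.ite (Primrec.eq.comp (fst.comp hq) (snd.comp (hn.comp fst)))
      (single (pair (snd.comp hq) (snd.comp fst))) (single (pair (fst.comp fst) (snd.comp snd)))
  exact list_casesOn snd (const []) hcons

theorem primrec_codeConfig_next : Primrec₂ CodeConfig.next := by
  have hk : Primrec fun x : (List ℕ × List ℕ) × CodeConfig => x.2.1 := fst.comp snd
  have he : Primrec fun x : (List ℕ × List ℕ) × CodeConfig => x.2.2.1 :=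
    fst.comp (snd.comp snd)
  have hw : Primrec fun x : (List ℕ × List ℕ) × CodeConfig => x.2.2.2 :=
    snd.comp (snd.comp snd)
  have hn : Primrec fun x : (List ℕ × List ℕ) × CodeConfig => x.2.1.1.unpair :=
    unpair.comp (fst.comp hk)
  have hp : Primrec fun x : (List ℕ × List ℕ) × CodeConfig => x.2.1.1.unpair.2.unpair :=
    unpair.comp (snd.comp hn)
  refine Primrec.ite (Primrec.eq.comp (fst.comp hn) (const 3)) ?_ ?_
  · refine list_flatMap (primrec_wordReads.comp (snd.comp fst) hw) ?_
    refine Primrec.ite (Primrec.eq.comp (primrec_satCode.comp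
      (pair (he.comp fst) (fst.comp snd)) (fst.comp (hp.comp fst))) (const true)) ?_ (const [])
    exact list_cons.comp (pair (pair (snd.comp (hp.comp fst)) (snd.comp (hk.comp fst)))
      (pair (he.comp fst) (snd.comp snd))) (const [])
  refine Primrec.ite (Primrec.eq.comp (fst.comp hn) (const 5)) ?_ ?_
  · refine list_map (fst.comp fst) ?_
    exact pair (pair (snd.comp (hp.comp fst)) (snd.comp (hk.comp fst)))
      (pair (primrec_envSet.comp (pair (he.comp fst) (pair (fst.comp (hp.comp fst)) snd)))
        (hw.comp fst))
  · exact list_map (primrec_controlCode.comp hk) (pair snd (snd.comp (snd.comp fst)))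

theorem primrec_valuePool : Primrec₂ valuePool := by
  refine list_append.comp snd (list_range.comp ?_)
  exact succ.comp (succ.comp (nat_add.comp (list_length.comp snd) fst))

theorem primrec_explored (ext : Bool) : Primrec₂ (explored ext) := by
  have hpool : Primrec fun i : ℕ × List ℕ => valuePool i.1 i.2 :=
    primrec_valuePool.comp fst snd
  have hparam : Primrec fun i : ℕ × List ℕ =>
      (valuePool i.1 i.2, bif ext then valuePool i.1 i.2 else []) := by
    cases ext
    · exact pair hpool (const [])
    · exact pair hpool hpool
  refine nat_rec (f := fun i : ℕ × List ℕ => [CodeConfig.initial i.1 i.2])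
    (g := fun i x => x.2 ++ x.2.flatMap (CodeConfig.next
      (valuePool i.1 i.2, bif ext then valuePool i.1 i.2 else []))) ?_ ?_
  · exact list_cons.comp (pair (pair fst (const [])) (pair (const []) snd)) (const [])
  · refine list_append.comp (snd.comp snd) (list_flatMap (snd.comp snd) ?_)
    exact primrec_codeConfig_next.comp (hparam.comp (fst.comp fst)) snd

theorem primrecRel_saturated (ext : Bool) : PrimrecRel (Saturated ext) := by
  have hmem : PrimrecRel fun (c : CodeConfig) (l : List CodeConfig) => c ∈ l := by
    refine (PrimrecRel.exists_mem_list (Primrec.eq (α := CodeConfig))).swap.of_eq ?_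
    simp
  exact (PrimrecRel.forall_mem_list hmem).comp₂ ((primrec_explored ext).comp fst
    (succ.comp snd)) (primrec_explored ext)

theorem primrecRel_found (ext : Bool) : PrimrecRel (Found ext) := by
  have h : PrimrecPred fun c : CodeConfig => c.1.1 = Nat.pair 1 0 :=
    Primrec.eq.comp (fst.comp fst) (const _)
  exact h.exists_mem_list.comp (primrec_explored ext)

open Classical in
/-- The verdict after `k` steps of exploration: `1` for acceptance, `2` for rejection. -/
noncomputable def verdict (i : ℕ × List ℕ) (k : ℕ) : ℕ :=
  if Found false i k then 1 else if Found true i k then 0 else 2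

open Classical in
/-- The verdict once both explorations are complete. -/
noncomputable def verdictProcedure (n : ℕ) : Part ℕ :=
  (Nat.rfind fun k => Part.some <| decide
    (Saturated false (n.unpair.1, Denumerable.ofNat (List ℕ) n.unpair.2) k ∧
      Saturated true (n.unpair.1, Denumerable.ofNat (List ℕ) n.unpair.2) k)).map
    (verdict (n.unpair.1, Denumerable.ofNat (List ℕ) n.unpair.2))

theorem partrec_verdictProcedure : Nat.Partrec verdictProcedure := by
  classical
  have hi : Primrec fun n : ℕ => (n.unpair.1, Denumerable.ofNat (List ℕ) n.unpair.2) :=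
    pair (fst.comp unpair) ((Primrec.ofNat _).comp (snd.comp unpair))
  have hi₂ : Primrec fun x : ℕ × ℕ =>
      (x.1.unpair.1, Denumerable.ofNat (List ℕ) x.1.unpair.2) := hi.comp fst
  refine Partrec.nat_iff.1 (Partrec.map (Partrec.rfind ?_) ?_)
  · refine Computable.partrec (Primrec.to_comp ?_)
    exact PrimrecPred.decide (((primrecRel_saturated false).comp hi₂ snd).and
      ((primrecRel_saturated true).comp hi₂ snd))
  · refine Primrec.to_comp ?_
    refine Primrec.ite ((primrecRel_found false).comp hi₂ snd) (const 1) ?_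
    exact Primrec.ite ((primrecRel_found true).comp hi₂ snd) (const 0) (const 2)

theorem exists_mem_verdictProcedure (φ : Formula) (w : List ℕ) :
    ∃ k, (∀ ext, Saturated ext (φ.code, w) k) ∧
      verdict (φ.code, w) k ∈ verdictProcedure (Nat.pair φ.code (Encodable.encode w)) := by
  classical
  obtain ⟨k₀, hk₀⟩ := exists_saturated_explored φ w
  obtain ⟨k, hk, -⟩ := Nat.rfind_min'
    (p := fun k => decide (Saturated false (φ.code, w) k ∧ Saturated true (φ.code, w) k))
    (m := k₀) (by simp [hk₀])
  have hs := Nat.rfind_spec hk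
  simp only [PFun.coe_val, Part.mem_some_iff, eq_comm (a := true), decide_eq_true_eq] at hs
  refine ⟨k, fun ext => by cases ext <;> simp [hs], ?_⟩
  rw [verdictProcedure, Nat.unpair_pair]
  simp only [Denumerable.ofNat_encode]
  exact Part.mem_map _ hk

end Computability

/-- The code of a list depends only on the codes of its entries, so a program for words over `ℕ`
receives the same input for a word over `D`. -/
theorem encode_map_encode {D : Type*} [Encodable D] (w : List D) :
    Encodable.encode (w.map Encodable.encode) = Encodable.encode w := by
  induction w with
  | nil => rfl
  | cons a w ih => simp [Encodable.encode_list_cons, ih]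

/-! ## The monitor -/

/-- The monitor that accepts a finite trace if a successful evaluation of the formula reads only
letters of that trace, and rejects it if no continuation satisfies the formula. -/
def monitorOf {D : Type*} [Infinite D] (φ : Formula) : Monitor D where
  acc w := Run Set.univ (listRead ∅) φ [] (fun _ => none) w
  rej w := ¬ Run Set.univ (listRead Set.univ) φ [] (fun _ => none) w
  consistent w h := by
    have := (h.1.append_stream (Stream'.const (Classical.arbitrary D))).prefix_of_stream
    exact h.2 this
  acc_irrevocable w y hwy h := h.mono_prefix hwy
  rej_irrevocable w y hwy h hy := by
    obtain ⟨z, rfl⟩ := hwy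
    obtain ⟨u, hu⟩ := hy.exists_append_stream
    rw [Stream'.append_append_stream] at hu
    exact h hu.prefix_of_stream

end RecHML

theorem mainTheorem11 (D : Type*) [Encodable D] [Infinite D] :
    ∃ synth : ℕ → Nat.Partrec.Code, Computable synth ∧
      ∀ φ : RecHML.Formula, φ.IsDisj → φ.IsClosed →
        ∃ m : RecHML.Monitor D,
          m.ComputedBy (synth φ.code) ∧
          m.Sound (φ.traces D) ∧
          m.SatisfactionComplete (φ.traces D) ∧
          m.ViolationOptimal (φ.traces D) := by
  classical
  obtain ⟨c, hc⟩ := Nat.Partrec.Code.exists_code.1 RecHML.partrec_verdictProcedure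
  -- The s-m-n theorem: the synthesised program is the uniform one with the formula's code fixed as
  -- first argument.
  refine ⟨c.curry, (Nat.Partrec.Code.primrec₂_curry.comp (Primrec.const c) Primrec.id).to_comp,
    fun φ hφ _ => ⟨RecHML.monitorOf φ, ?_, ⟨?_, ?_⟩, ?_, ?_⟩⟩
  · intro w
    obtain ⟨k, hk, hv⟩ := RecHML.exists_mem_verdictProcedure φ (w.map Encodable.encode)
    refine ⟨RecHML.verdict (φ.code, w.map Encodable.encode) k, ?_, ?_⟩
    · rw [Nat.Partrec.Code.eval_curry, hc, ← RecHML.encode_map_encode]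
      exact hv
    have hacc := (RecHML.found_iff_run (hk false)).trans RecHML.run_encode_iff
    have hrej := (RecHML.found_iff_run (hk true)).trans RecHML.run_encode_iff
    -- The verdict tests acceptance first; consistency ensures that this never hides a rejection.
    have hcons := (RecHML.monitorOf (D := D) φ).consistent w
    simp only [RecHML.monitorOf, cond_true, cond_false] at hacc hrej hcons ⊢
    rw [RecHML.verdict, ← hacc, ← hrej] at *
    split_ifs <;> simp_all
  · rintro t ⟨w, u, rfl, h⟩
    exact (RecHML.Formula.mem_traces_iff hφ).2 (h.append_stream u)
  · rintro t ⟨w, u, rfl, h⟩ ht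
    exact h ((RecHML.Formula.mem_traces_iff hφ).1 ht).prefix_of_stream
  · intro t ht
    exact ((RecHML.Formula.mem_traces_iff hφ).1 ht).exists_prefix
  · intro w hw h
    obtain ⟨u, hu⟩ := h.exists_append_stream
    exact hw u ((RecHML.Formula.mem_traces_iff hφ).2 hu)
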